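/- Let $A$ be a principal ideal domain, $X$ a locally compact Hausdorff space, $f\colon X\to\mathbb{R}$ a continuous function, $S\subset X$ a closed subset, $V$ an open subset of $S$ (for the subspace topology) and $x\in V$. For a topological space $Y$ let $A_Y$ be the constant sheaf with fiber $A$. For a closed subset $Z\subset Y$ let $\Gamma_Z$ be the left exact functor from sheaves of $A$-modules on $Y$ to sheaves of $A$-modules on $Y$ given by $\Gamma_Z(\mathcal F)(U)=\operatorname{Ker}(\mathcal F(U)\to\mathcal F(U\setminus Z))$. For a continuous function $g\colon Y\to\mathbb R$, a point $y\in Y$ and a sheaf $\mathcal F$ of $A$-modules on $Y$, the local Morse data of $\mathcal F$ and $g$ at $y$ is the $\mathbb Z$-graded $A$-module $$\operatorname{LMD}^{i}(\mathcal F,g,y):=H^{i}\bigl(R\Gamma_{\{g\ge g(y)\}}\mathcal F\bigr)_{y}\qquad(i\in\mathbb Z).$$ Let $\iota\colon S\to X$ be the inclusion and $(A_X)_S:=\iota_!\,\iota^{-1}A_X$, where $\iota_!$ is the direct image with proper supports. Then for every $i\in\mathbb Z$ there are isomorphisms of $A$-modules $$\operatorname{LMD}^{i}((A_X)_S,f,x)\simeq\operatorname{LMD}^{i}(A_S,f|_S,x)\simeq\operatorname{LMD}^{i}(A_V,f|_V,x)\simeq\varinjlim_{U}\tilde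 H^{i-1}(S\cap\{f<f(x)\}\cap U;A),$$ where $U$ runs over the open neighbourhoods of $x$ in $S$ and the transition maps are the restriction maps. Here $\tilde H^{m}(W;A)$, $m\in\mathbb Z$, is the reduced sheaf cohomology of $W$ with coefficients in the constant sheaf $A_W$: it is $H^{m}(W;A)$ for $m\ge 1$, the cokernel (for $m=0$) and the kernel (for $m=-1$) of the natural map $A\to H^{0}(W;A)$, and $0$ for $m\le -2$; in particular $\tilde H^{-1}(\emptyset;A)=A$. -/

import Mathlib

open CategoryTheory TopologicalSpace Opposite

universe u

noncomputable section

namespace LocalMorse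

variable {A : Type u} [CommRing A]

/-! ### Subsheaves cut out by a local condition -/

/-- A family of submodules `P U ⊆ F(U)` that is stable under restriction. -/
structure SubFamily {X : TopCat.{u}} (F : TopCat.Sheaf (ModuleCat.{u} A) X) where
  /-- the sections over `U` satisfying the condition -/
  carrier : ∀ U : Opens X, Submodule A (F.presheaf.obj (op U))
  /-- stability under restriction -/
  res : ∀ {U V : Opens X} (i : V ⟶ U) (s : F.presheaf.obj (op U)),
    s ∈ carrier U → (F.presheaf.map i.op) s ∈ carrier V

variable {X : TopCat.{u}} {F : TopCat.Sheaf (ModuleCat.{u} A) X}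

/-- The presheaf `U ↦ P U`. -/
def SubFamily.presheaf (P : SubFamily F) : TopCat.Presheaf (ModuleCat.{u} A) X where
  obj U := ModuleCat.of A (P.carrier U.unop)
  map {U V} i := ModuleCat.ofHom
    ((F.presheaf.map i).hom.restrict (fun s hs => P.res i.unop s hs))
  map_id U := by
    ext s
    change (F.presheaf.map (𝟙 U)) s.1 = s.1
    simp
  map_comp {U V W} i j := by
    ext s
    change (F.presheaf.map (i ≫ j)) s.1 = (F.presheaf.map j) ((F.presheaf.map i) s.1)
    simp

theorem SubFamily.presheaf_map_coe (P : SubFamily F) {U V : (Opens X)ᵒᵖ} (i : U ⟶ V)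
    (s : P.carrier U.unop) :
    ((P.presheaf.map i) s : P.carrier V.unop).1 = (F.presheaf.map i) s.1 := rfl

/-- If the condition is local, then the sections satisfying it form a sheaf. -/
theorem SubFamily.isSheaf (P : SubFamily F)
    (hloc : ∀ {ι : Type u} (U : ι → Opens X) (s : F.presheaf.obj (op (iSup U))),
      (∀ i, (F.presheaf.map (Opens.leSupr U i).op) s ∈ P.carrier (U i)) →
        s ∈ P.carrier (iSup U)) :
    P.presheaf.IsSheaf := by
  rw [TopCat.Presheaf.isSheaf_iff_isSheafUniqueGluing]
  intro ι U sf hsf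
  obtain ⟨s, hs, hu⟩ := TopCat.Sheaf.existsUnique_gluing F U
    (fun i => (show P.carrier (U i) from sf i).1)
    (fun i j => congrArg (fun t : P.carrier (U i ⊓ U j) => t.1) (hsf i j))
  refine ⟨(⟨s, hloc U s (fun i => ?_)⟩ : P.carrier (iSup U)), fun i => ?_, fun t ht => ?_⟩
  · rw [hs i]
    exact (show P.carrier (U i) from sf i).2
  · exact Subtype.ext (hs i)
  · exact Subtype.ext (hu (show P.carrier (iSup U) from t).1
      (fun i => congrArg (fun t : P.carrier (U i) => t.1) (ht i)))

/-! ### Sections supported in a closed subset -/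

/-- `Γ_Z(U; F)`: the sections of `F` over `U` that vanish on `U \ Z`. -/
def supportedFamily (Z : Closeds X) (F : TopCat.Sheaf (ModuleCat.{u} A) X) : SubFamily F where
  carrier U := LinearMap.ker
    (F.presheaf.map (homOfLE (inf_le_left : U ⊓ Z.compl ≤ U)).op).hom
  res {U V} i s hs := by
    rw [LinearMap.mem_ker] at hs ⊢
    have h := congrArg (F.presheaf.map
      (homOfLE (inf_le_inf_right Z.compl i.le : V ⊓ Z.compl ≤ U ⊓ Z.compl)).op) hs
    rw [map_zero] at h
    rw [← h]
    change (F.presheaf.map _) ((F.presheaf.map _) s) = (F.presheaf.map _) ((F.presheaf.map _) s)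
    rw [← ConcreteCategory.comp_apply, ← ConcreteCategory.comp_apply, ← F.presheaf.map_comp,
      ← F.presheaf.map_comp]
    rfl

theorem mem_supportedFamily (Z : Closeds X) (F : TopCat.Sheaf (ModuleCat.{u} A) X)
    (U : Opens X) (s : F.presheaf.obj (op U)) :
    s ∈ (supportedFamily Z F).carrier U ↔
      (F.presheaf.map (homOfLE (inf_le_left : U ⊓ Z.compl ≤ U)).op) s = 0 := Iff.rfl

theorem supportedFamily_isSheaf (Z : Closeds X) (F : TopCat.Sheaf (ModuleCat.{u} A) X) :
    (supportedFamily Z F).presheaf.IsSheaf := by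
  refine SubFamily.isSheaf _ (fun {ι} U s hs => ?_)
  rw [mem_supportedFamily]
  refine TopCat.Sheaf.eq_of_locally_eq' F (fun i => U i ⊓ Z.compl) _
    (fun i => homOfLE (inf_le_inf_right _ (le_iSup U i))) ?_ _ _ (fun i => ?_)
  · rw [iSup_inf_eq]
  · have h := hs i
    rw [mem_supportedFamily] at h
    rw [map_zero, ← h, ← ConcreteCategory.comp_apply, ← ConcreteCategory.comp_apply,
      ← F.presheaf.map_comp, ← F.presheaf.map_comp]
    rfl

variable (A) in
/-- The functor `Γ_Z : Mod(A_X) ⥤ Mod(A_X)` of sections supported in the closed subset `Z`,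
`Γ_Z(F)(U) = ker (F(U) → F(U \ Z))`. -/
def sectionsWithSupport (Z : Closeds X) :
    TopCat.Sheaf (ModuleCat.{u} A) X ⥤ TopCat.Sheaf (ModuleCat.{u} A) X where
  obj F := ⟨(supportedFamily Z F).presheaf, supportedFamily_isSheaf Z F⟩
  map {F G} φ := ⟨
    { app := fun U => ModuleCat.ofHom ((φ.1.app U).hom.restrict (fun s hs => by
        have hs' := (mem_supportedFamily Z F U.unop s).1 hs
        refine (mem_supportedFamily Z G U.unop _).2 ?_
        have h := NatTrans.naturality_apply φ.1
          (homOfLE (inf_le_left : U.unop ⊓ Z.compl ≤ U.unop)).op s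
        exact h.symm.trans ((congrArg _ hs').trans (map_zero _))))
      naturality := fun U V i => by
        ext s
        exact Subtype.ext (NatTrans.naturality_apply φ.1 i
          (show (supportedFamily Z F).carrier U.unop from s).1) }⟩
  map_id F := by
    apply CategoryTheory.Sheaf.hom_ext
    rfl
  map_comp f g := by
    apply CategoryTheory.Sheaf.hom_ext
    rfl

instance (Z : Closeds X) : (sectionsWithSupport A Z).Additive where
  map_add := by
    intros
    apply CategoryTheory.Sheaf.hom_ext
    rfl

/-! ### Direct image with proper supports -/

/-- The support of a section: the points where its germ does not vanish. -/
def supp (F : TopCat.Sheaf (ModuleCat.{u} A) X) {U : Opens X} (s : F.presheaf.obj (op U)) :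
    Set X :=
  {x | ∃ hx : x ∈ U, (F.presheaf.germ U x hx) s ≠ 0}

theorem supp_subset (F : TopCat.Sheaf (ModuleCat.{u} A) X) {U : Opens X}
    (s : F.presheaf.obj (op U)) : supp F s ⊆ U := fun _ h => h.1

theorem supp_add_subset (F : TopCat.Sheaf (ModuleCat.{u} A) X) {U : Opens X}
    (s t : F.presheaf.obj (op U)) : supp F (s + t) ⊆ supp F s ∪ supp F t := by
  rintro y ⟨hy, h⟩
  by_contra hn
  rw [Set.mem_union, not_or] at hn
  have h1 := not_not.1 (fun h => hn.1 ⟨hy, h⟩)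
  have h2 := not_not.1 (fun h => hn.2 ⟨hy, h⟩)
  exact h (by rw [map_add, h1, h2, add_zero])

theorem supp_smul_subset (F : TopCat.Sheaf (ModuleCat.{u} A) X) {U : Opens X} (a : A)
    (s : F.presheaf.obj (op U)) : supp F (a • s) ⊆ supp F s := by
  rintro y ⟨hy, h⟩
  refine ⟨hy, fun h0 => h ?_⟩
  have := (F.presheaf.germ U y hy).hom.map_smul a s
  exact this.trans ((congrArg (a • ·) h0).trans (smul_zero a))

variable {Y : TopCat.{u}}

/-- For a section `s` of `G` over `f⁻¹(U)`, the map `f : supp s → U` is proper. -/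
def HasProperSupport (f : Y ⟶ X) (G : TopCat.Sheaf (ModuleCat.{u} A) Y) (U : Opens X)
    (s : G.presheaf.obj (op ((Opens.map f).obj U))) : Prop :=
  IsProperMap (fun y : supp G s => (⟨f y.1, supp_subset G s y.2⟩ : U))

theorem hasProperSupport_iff [T2Space X] [LocallyCompactSpace X] (f : Y ⟶ X)
    (G : TopCat.Sheaf (ModuleCat.{u} A) Y) (U : Opens X)
    (s : G.presheaf.obj (op ((Opens.map f).obj U))) :
    HasProperSupport f G U s ↔
      ∀ K : Set X, K ⊆ U → IsCompact K → IsCompact (supp G s ∩ f ⁻¹' K) := by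
  have : LocallyCompactSpace U := U.2.locallyCompactSpace
  have key : ∀ K : Set U, (Subtype.val : supp G s → Y) ''
      ((fun y : supp G s => (⟨f y.1, supp_subset G s y.2⟩ : U)) ⁻¹' K) =
        supp G s ∩ f ⁻¹' (Subtype.val '' K) := by
    intro K
    ext y
    constructor
    · rintro ⟨y, hy, rfl⟩
      exact ⟨y.2, _, hy, rfl⟩
    · rintro ⟨hy, u, hu, huy⟩
      refine ⟨⟨y, hy⟩, ?_, rfl⟩
      rw [Set.mem_preimage]
      convert hu
      exact Subtype.ext huy.symm
  rw [HasProperSupport, isProperMap_iff_isCompact_preimage]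
  constructor
  · rintro ⟨-, h⟩ K hKU hK
    have hK' : (Subtype.val : U → X) '' (Subtype.val ⁻¹' K) = K := by
      exact (Subtype.image_preimage_coe _ _).trans (Set.inter_eq_right.2 hKU)
    have h2 := (h (K := (Subtype.val : U → X) ⁻¹' K)
      (by rwa [Subtype.isCompact_iff, hK'])).image continuous_subtype_val
    rwa [key, hK'] at h2
  · intro h
    refine ⟨by fun_prop, fun K hK => ?_⟩
    rw [Subtype.isCompact_iff, key]
    refine h _ ?_ (Subtype.isCompact_iff.1 hK)
    rintro _ ⟨u, -, rfl⟩
    exact u.2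

theorem isClosed_supp_inter (F : TopCat.Sheaf (ModuleCat.{u} A) X) {U : Opens X}
    (s : F.presheaf.obj (op U)) : ∃ C : Set X, IsClosed C ∧ supp F s = C ∩ U := by
  refine ⟨closure (supp F s), isClosed_closure, Set.Subset.antisymm
    (fun x hx => ⟨subset_closure hx, hx.1⟩) ?_⟩
  rintro x ⟨hx, hxU⟩
  refine ⟨hxU, fun h0 => ?_⟩
  obtain ⟨W, hxW, iU, iV, h⟩ := TopCat.Presheaf.germ_eq F.presheaf x hxU hxU s 0
    (by rw [h0, map_zero])
  obtain ⟨y, hyW, hyU, hy⟩ := mem_closure_iff.1 hx W W.2 hxW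
  apply hy
  rw [← TopCat.Presheaf.germ_res_apply F.presheaf iU y hyW s, h, map_zero, map_zero]

/-- The sections of `f_* G` with proper support. -/
def properFamily [T2Space X] [LocallyCompactSpace X] (f : Y ⟶ X)
    (G : TopCat.Sheaf (ModuleCat.{u} A) Y) :
    SubFamily ((TopCat.Sheaf.pushforward (ModuleCat.{u} A) f).obj G) where
  carrier U :=
    { carrier := {s | HasProperSupport f G U s}
      zero_mem' := by
        refine (hasProperSupport_iff f G U _).2 (fun K _ _ => ?_)
        convert isCompact_empty
        rw [Set.eq_empty_iff_forall_notMem]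
        rintro y ⟨⟨hy, h⟩, -⟩
        exact h (map_zero _)
      add_mem' := by
        intro s t hs ht
        refine (hasProperSupport_iff f G U _).2 (fun K hKU hK => ?_)
        have hc := ((hasProperSupport_iff f G U s).1 hs K hKU hK).union
          ((hasProperSupport_iff f G U t).1 ht K hKU hK)
        obtain ⟨C, hC, hCU⟩ := isClosed_supp_inter G (U := (Opens.map f).obj U) (s + t)
        have hsub := supp_add_subset G (U := (Opens.map f).obj U) s t
        convert hc.inter_right hC using 1
        ext y
        constructor
        · rintro ⟨hy, hyK⟩
          refine ⟨?_, (hCU.subset hy).1⟩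
          exact (hsub hy).imp (fun h => ⟨h, hyK⟩) (fun h => ⟨h, hyK⟩)
        · rintro ⟨h | h, hyC⟩
          · exact ⟨hCU.superset ⟨hyC, h.1.1⟩, h.2⟩
          · exact ⟨hCU.superset ⟨hyC, h.1.1⟩, h.2⟩
      smul_mem' := by
        intro a s hs
        refine (hasProperSupport_iff f G U _).2 (fun K hKU hK => ?_)
        have hc := (hasProperSupport_iff f G U s).1 hs K hKU hK
        obtain ⟨C, hC, hCU⟩ := isClosed_supp_inter G (U := (Opens.map f).obj U) (a • s)
        convert hc.inter_right hC using 1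
        ext y
        constructor
        · rintro ⟨hy, hyK⟩
          exact ⟨⟨supp_smul_subset G (U := (Opens.map f).obj U) a s hy, hyK⟩, (hCU.subset hy).1⟩
        · rintro ⟨h, hyC⟩
          exact ⟨hCU.superset ⟨hyC, h.1.1⟩, h.2⟩ }
  res {U V} i s hs := by
    refine (hasProperSupport_iff f G V _).2 (fun K hKV hK => ?_)
    have hc := (hasProperSupport_iff f G U s).1 hs K (hKV.trans i.le) hK
    convert hc using 1
    ext y
    refine and_congr_left (fun hyK => ?_)
    have hyV : y ∈ (Opens.map f).obj V := hKV hyK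
    have hg := TopCat.Presheaf.germ_res_apply G.presheaf ((Opens.map f).map i) y hyV s
    constructor
    · rintro ⟨_, h⟩
      exact ⟨(Opens.map f).map i |>.le hyV, fun h0 => h (hg.trans h0)⟩
    · rintro ⟨_, h⟩
      exact ⟨hyV, fun h0 => h (hg.symm.trans h0)⟩

theorem properFamily_isSheaf [T2Space X] [LocallyCompactSpace X] (f : Y ⟶ X)
    (G : TopCat.Sheaf (ModuleCat.{u} A) Y) : (properFamily f G).presheaf.IsSheaf := by
  refine SubFamily.isSheaf _ (fun {ι} U s hs => ?_)
  refine (hasProperSupport_iff f G (iSup U) s).2 (fun K hKU hK => ?_)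
  have hcov : K ⊆ ⋃ i, (U i : Set X) := by rwa [← Opens.coe_iSup]
  obtain ⟨t, ht⟩ := hK.elim_finite_subcover _ (fun i => (U i).2) hcov
  obtain ⟨L, hL, hLU, rfl⟩ := hK.finite_compact_cover t (fun i => (U i : Set X))
    (fun i _ => (U i).2) ht
  have : supp G s ∩ f ⁻¹' (⋃ i ∈ t, L i) = ⋃ i ∈ t, (supp G s ∩ f ⁻¹' (L i)) := by
    ext y
    simp only [Set.mem_inter_iff, Set.mem_preimage, Set.mem_iUnion]
    tauto
  rw [this]
  refine t.isCompact_biUnion (fun i _ => ?_)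
  convert (hasProperSupport_iff f G (U i) _).1 (hs i) (L i) (hLU i) (hL i) using 1
  ext y
  refine and_congr_left (fun hyK => ?_)
  have hyV : y ∈ (Opens.map f).obj (U i) := hLU i hyK
  have hg := TopCat.Presheaf.germ_res_apply G.presheaf
    ((Opens.map f).map (Opens.leSupr U i)) y hyV s
  constructor
  · rintro ⟨_, h⟩
    exact ⟨hyV, fun h0 => h (hg.symm.trans h0)⟩
  · rintro ⟨_, h⟩
    exact ⟨(Opens.map f).map (Opens.leSupr U i) |>.le hyV, fun h0 => h (hg.trans h0)⟩

/-- The direct image with proper supports `f_! G`: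
`(f_! G)(U) = {s ∈ G(f⁻¹(U)) | f : supp s → U is proper}`. -/
def properPushforward [T2Space X] [LocallyCompactSpace X] (f : Y ⟶ X)
    (G : TopCat.Sheaf (ModuleCat.{u} A) Y) : TopCat.Sheaf (ModuleCat.{u} A) X :=
  ⟨(properFamily f G).presheaf, properFamily_isSheaf f G⟩

/-! ### Constant sheaves and the sheaf `F_Z` -/

variable (A) in
/-- The constant sheaf `A_X`: the sheafification of the constant presheaf with value `A`. -/
def constSheaf (X : TopCat.{u}) : TopCat.Sheaf (ModuleCat.{u} A) X :=
  (constantSheaf (Opens.grothendieckTopology X) (ModuleCat.{u} A)).obj (ModuleCat.of A A)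

/-- The inclusion of a subspace, as a morphism of `TopCat`. -/
def incl {X : Type u} [TopologicalSpace X] (Z : Set X) : TopCat.of Z ⟶ TopCat.of X :=
  TopCat.ofHom ⟨Subtype.val, continuous_subtype_val⟩

/-- `F_Z = i_! i⁻¹ F`, where `i : Z → X` is the inclusion of a subspace. -/
def cutOff {X : Type u} [TopologicalSpace X] [T2Space X] [LocallyCompactSpace X]
    (F : TopCat.Sheaf (ModuleCat.{u} A) (TopCat.of X)) (Z : Set X) :
    TopCat.Sheaf (ModuleCat.{u} A) (TopCat.of X) :=
  haveI : T2Space (TopCat.of X) := ‹T2Space X›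
  haveI : LocallyCompactSpace (TopCat.of X) := ‹LocallyCompactSpace X›
  properPushforward (incl Z) ((TopCat.Sheaf.pullback (ModuleCat.{u} A) (incl Z)).obj F)

/-! ### Local Morse data -/

/-- The closed subset `{f ≥ f(x)}`. -/
def superlevel {X : Type u} [TopologicalSpace X] (f : C(X, ℝ)) (x : X) :
    Closeds (TopCat.of X) :=
  ⟨{y : X | f x ≤ f y}, isClosed_le continuous_const f.continuous⟩

/-- The local Morse data of a sheaf `F`, in degree `i ∈ ℤ`: the stalk at `x` of
`H^i(RΓ_{f ≥ f(x)} F)`, which is the right derived functor `R^i Γ_{f ≥ f(x)}` at `F` for `i ≥ 0`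
and zero for `i < 0`. -/
def LMD {X : Type u} [TopologicalSpace X] (F : TopCat.Sheaf (ModuleCat.{u} A) (TopCat.of X))
    (f : C(X, ℝ)) (x : X) : ℤ → ModuleCat.{u} A
  | Int.ofNat n =>
      (((sectionsWithSupport A (superlevel f x)).rightDerived n).obj F).presheaf.stalk
        (X := TopCat.of X) x
  | Int.negSucc _ => ModuleCat.of A PUnit

/-! ### Reduced cohomology of open subsets -/

variable (A) in
/-- The sections functor `Γ(W; -)` for an open subset `W` of `X`. -/
def sections (W : (Opens X)ᵒᵖ) : TopCat.Sheaf (ModuleCat.{u} A) X ⥤ ModuleCat.{u} A where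
  obj F := F.presheaf.obj W
  map φ := φ.1.app W
  map_id _ := rfl
  map_comp _ _ := rfl

instance (W : (Opens X)ᵒᵖ) : (sections A W).Additive where
  map_add := rfl

variable (A) in
/-- The restriction `Γ(W; -) ⟶ Γ(W'; -)` for `W' ⊆ W`. -/
def sectionsRes {W W' : (Opens X)ᵒᵖ} (i : W ⟶ W') : sections A W ⟶ sections A W' where
  app F := F.presheaf.map i
  naturality _ _ φ := (φ.1.naturality i).symm

/-- The presheaf `W ↦ H^n(W; F) = R^n Γ(W; -) (F)` on `X`. -/
def cohomology (F : TopCat.Sheaf (ModuleCat.{u} A) X) (n : ℕ) :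
    (Opens X)ᵒᵖ ⥤ ModuleCat.{u} A where
  obj W := ((sections A W).rightDerived n).obj F
  map i := (NatTrans.rightDerived (sectionsRes A i) n).app F
  map_id W := by
    have : sectionsRes A (𝟙 W) = 𝟙 _ := by
      ext F : 2
      exact F.presheaf.map_id W
    rw [this, NatTrans.rightDerived_id]
    rfl
  map_comp i j := by
    have : sectionsRes A (i ≫ j) = sectionsRes A i ≫ sectionsRes A j := by
      ext F : 2
      exact F.presheaf.map_comp i j
    rw [this, NatTrans.rightDerived_comp]
    rfl

theorem toRightDerivedZero_naturality {C D : Type*} [Category* C] [Category* D] [Abelian C]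
    [Abelian D] [HasInjectiveResolutions C] {G H : C ⥤ D} [G.Additive] [H.Additive]
    (α : G ⟶ H) (M : C) :
    α.app M ≫ H.toRightDerivedZero.app M =
      G.toRightDerivedZero.app M ≫ (NatTrans.rightDerived α 0).app M := by
  have I := injectiveResolution M
  have h : α.app M ≫ I.toRightDerivedZero' H = I.toRightDerivedZero' G ≫
      HomologicalComplex.cyclesMap
        ((NatTrans.mapHomologicalComplex α (ComplexShape.up ℕ)).app I.cocomplex) 0 := by
    rw [← cancel_mono (HomologicalComplex.iCycles _ _), Category.assoc, Category.assoc,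
      InjectiveResolution.toRightDerivedZero'_comp_iCycles, HomologicalComplex.cyclesMap_i,
      InjectiveResolution.toRightDerivedZero'_comp_iCycles_assoc]
    exact (α.naturality (I.ι.f 0)).symm
  rw [I.toRightDerivedZero_eq, I.toRightDerivedZero_eq, I.rightDerived_app_eq]
  let KG := (G.mapHomologicalComplex (ComplexShape.up ℕ)).obj I.cocomplex
  let KH := (H.mapHomologicalComplex (ComplexShape.up ℕ)).obj I.cocomplex
  let a : KG ⟶ KH := (NatTrans.mapHomologicalComplex α (ComplexShape.up ℕ)).app I.cocomplex
  let eG : (G.rightDerived 0).obj M ≅ KG.homology 0 := I.isoRightDerivedObj G 0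
  let eH : (H.rightDerived 0).obj M ≅ KH.homology 0 := I.isoRightDerivedObj H 0
  change α.app M ≫ I.toRightDerivedZero' H ≫ KH.homologyπ 0 ≫ eH.inv =
    (I.toRightDerivedZero' G ≫ KG.homologyπ 0 ≫ eG.inv) ≫
      eG.hom ≫ HomologicalComplex.homologyMap a 0 ≫ eH.inv
  have h' : α.app M ≫ I.toRightDerivedZero' H =
      I.toRightDerivedZero' G ≫ HomologicalComplex.cyclesMap a 0 := h
  rw [reassoc_of% h', Category.assoc, Category.assoc, Iso.inv_hom_id_assoc,
    HomologicalComplex.homologyπ_naturality_assoc]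

/-- The natural map `Γ(W; F) ⟶ H^0(W; F)`. -/
def toCohomologyZero (F : TopCat.Sheaf (ModuleCat.{u} A) X) :
    F.presheaf ⟶ cohomology F 0 where
  app W := (sections A W).toRightDerivedZero.app F
  naturality _ _ i := toRightDerivedZero_naturality (sectionsRes A i) F

variable (A X) in
/-- The natural map `A ⟶ Γ(W; A_X)` sending `a` to the constant section `a`. -/
def constSection :
    (Functor.const (Opens X)ᵒᵖ).obj (ModuleCat.of A A) ⟶ (constSheaf A X).presheaf :=
  toSheafify (Opens.grothendieckTopology X) ((Functor.const (Opens X)ᵒᵖ).obj (ModuleCat.of A A))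

variable (A X) in
/-- The augmentation `A ⟶ H^0(W; A)`, natural in the open subset `W ⊆ X`. -/
def augmentation :
    (Functor.const (Opens X)ᵒᵖ).obj (ModuleCat.of A A) ⟶ cohomology (constSheaf A X) 0 :=
  constSection A X ≫ toCohomologyZero (constSheaf A X)

variable (A X) in
/-- The presheaf `W ↦ H̃^m(W; A)`, `m ∈ ℤ`, of reduced cohomology on the open subsets of `X`,
with coefficients in the constant sheaf: the cohomology of the augmented complex, i.e.
`H^m(W; A)` for `m ≥ 1`, the cokernel and the kernel of the augmentation `A ⟶ H^0(W; A)` for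
`m = 0` and `m = -1`, and zero for `m ≤ -2`. -/
def reducedCohomology : ℤ → ((Opens X)ᵒᵖ ⥤ ModuleCat.{u} A)
  | Int.ofNat 0 => Limits.cokernel (augmentation A X)
  | Int.ofNat (n + 1) => cohomology (constSheaf A X) (n + 1)
  | Int.negSucc 0 => Limits.kernel (augmentation A X)
  | Int.negSucc (_ + 1) => (Functor.const _).obj (ModuleCat.of A PUnit)

/-- The direct limit of `H̃^m({f < f(x)} ∩ U; A)` over the open neighbourhoods `U` of `x`, where
`{f < f(x)} ∩ U` is regarded as an open subset of the space `{f < f(x)}`. -/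
def limReducedCohomology (A : Type u) [CommRing A] {X : Type u} [TopologicalSpace X]
    (f : C(X, ℝ)) (x : X) (m : ℤ) : ModuleCat.{u} A :=
  Limits.colimit
    ((OpenNhds.inclusion (X := TopCat.of X) x).op ⋙
      (Opens.map (incl {y : X | f y < f x})).op ⋙
        reducedCohomology A (TopCat.of {y : X | f y < f x}) m)

end LocalMorse

end

/-!
Local Morse data are the right derived functors of `F ↦ (Γ_{f ≥ f(x)} F)_x`, since taking stalks is
exact. Direct image along a closed embedding and restriction to an open subset are exact, preserve
injective sheaves and commute with this functor, hence do not change local Morse data; moreover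
`ι_! = ι_*` when `ι` is closed, and inverse images of constant sheaves are constant.

For the last isomorphism let `j` be the inclusion of `{f < f(x)}`. Injective sheaves are flasque, so
`0 ⟶ Γ_{f ≥ f(x)} J ⟶ J ⟶ j_* j⁻¹ J ⟶ 0` is exact on presheaves for injective `J`. Taking stalks at
`x` gives a long exact sequence of derived functors whose middle term vanishes in positive degrees
and is `A` in degree `0`, while the third term is `colim_U H^n({f < f(x)} ∩ U; A)`; the map between
them in degree `0` is the augmentation, so its kernel and cokernel are the reduced cohomology
modules in degrees `-1` and `0`.
-/

noncomputable section

namespace LocalMorse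

open Topology Limits

section RightDerived

variable {B C D D' : Type*} [Category* B] [Category* C] [Category* D] [Category* D']
  [Abelian B] [Abelian C] [Abelian D] [Abelian D']

section ExactFunctors

variable [HasInjectiveResolutions C]

/-- The right derived functors as the cohomology of an injective resolution: Mathlib's
`InjectiveResolution.isoRightDerivedObj`, with the target in terms of `HomologicalComplex.homology`
rather than `HomologicalComplex.homologyFunctor`. -/
def rightDerivedHomologyIso (G : C ⥤ D) [G.Additive] {M : C} (I : InjectiveResolution M) (n : ℕ) :
    (G.rightDerived n).obj M ≅
      ((G.mapHomologicalComplex (ComplexShape.up ℕ)).obj I.cocomplex).homology n :=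
  I.isoRightDerivedObj G n

theorem rightDerivedHomologyIso_hom_naturality {G H : C ⥤ D} [G.Additive] [H.Additive] (τ : G ⟶ H)
    {M : C} (I : InjectiveResolution M) (n : ℕ) :
    (NatTrans.rightDerived τ n).app M ≫ (rightDerivedHomologyIso H I n).hom =
      (rightDerivedHomologyIso G I n).hom ≫ HomologicalComplex.homologyMap
        ((NatTrans.mapHomologicalComplex τ (ComplexShape.up ℕ)).app I.cocomplex) n :=
  (Iso.eq_comp_inv _).1 ((I.rightDerived_app_eq τ n).trans (Category.assoc _ _ _).symm)

/-- An exact functor commutes with the cohomology of cochain complexes. -/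
def homologyMapComplexIso (L : D ⥤ D') [L.Additive] [L.PreservesHomology] (K : CochainComplex D ℕ)
    (n : ℕ) :
    ((L.mapHomologicalComplex (ComplexShape.up ℕ)).obj K).homology n ≅ L.obj (K.homology n) :=
  (K.sc n).mapHomologyIso L

theorem homologyMapComplexIso_hom_naturality {L L' : D ⥤ D'} [L.Additive] [L'.Additive]
    [L.PreservesHomology] [L'.PreservesHomology] (τ : L ⟶ L') (K : CochainComplex D ℕ) (n : ℕ) :
    HomologicalComplex.homologyMap
          ((NatTrans.mapHomologicalComplex τ (ComplexShape.up ℕ)).app K) n ≫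
        (homologyMapComplexIso L' K n).hom =
      (homologyMapComplexIso L K n).hom ≫ τ.app (K.homology n) :=
  (Iso.eq_comp_inv _).1 (((K.sc n).homologyMap_mapNatTrans τ).trans (Category.assoc _ _ _).symm)

/-- An exact functor `L` commutes with cohomology, so that `Rⁿ(L ∘ G) ≅ L ∘ RⁿG`. -/
def rightDerivedCompIso (G : C ⥤ D) [G.Additive] (L : D ⥤ D') [L.Additive] [L.PreservesHomology]
    (n : ℕ) (M : C) : ((G ⋙ L).rightDerived n).obj M ≅ L.obj ((G.rightDerived n).obj M) :=
  let I := injectiveResolution M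
  rightDerivedHomologyIso (G ⋙ L) I n ≪≫
    homologyMapComplexIso L ((G.mapHomologicalComplex (ComplexShape.up ℕ)).obj I.cocomplex) n ≪≫
    L.mapIso (rightDerivedHomologyIso G I n).symm

theorem rightDerivedCompIso_hom_naturality (G : C ⥤ D) [G.Additive] {L L' : D ⥤ D'} [L.Additive]
    [L'.Additive] [L.PreservesHomology] [L'.PreservesHomology] (τ : L ⟶ L') (n : ℕ) (M : C) :
    (NatTrans.rightDerived (Functor.whiskerLeft G τ) n).app M ≫
        (rightDerivedCompIso G L' n M).hom =
      (rightDerivedCompIso G L n M).hom ≫ τ.app ((G.rightDerived n).obj M) := by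
  let I := injectiveResolution M
  let K := (G.mapHomologicalComplex (ComplexShape.up ℕ)).obj I.cocomplex
  let H (N : D ⥤ D') [N.Additive] :=
    ((N.mapHomologicalComplex (ComplexShape.up ℕ)).obj K).homology n
  let e (N : D ⥤ D') [N.Additive] : ((G ⋙ N).rightDerived n).obj M ≅ H N :=
    rightDerivedHomologyIso (G ⋙ N) I n
  have he : (NatTrans.rightDerived (Functor.whiskerLeft G τ) n).app M ≫ (e L').hom =
      (e L).hom ≫ HomologicalComplex.homologyMap
        ((NatTrans.mapHomologicalComplex τ (ComplexShape.up ℕ)).app K) n :=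
    rightDerivedHomologyIso_hom_naturality (Functor.whiskerLeft G τ) I n
  change _ ≫ (e L').hom ≫ (homologyMapComplexIso L' K n).hom ≫ L'.map _ =
    ((e L).hom ≫ (homologyMapComplexIso L K n).hom ≫ L.map _) ≫ _
  rw [reassoc_of% he, reassoc_of% (homologyMapComplexIso_hom_naturality τ K n), Category.assoc,
    Category.assoc, τ.naturality]

/-- The image of an injective resolution under an exact functor that preserves injective
objects. -/
def mapInjectiveResolution (E : B ⥤ C) [E.Additive] [E.PreservesHomology]
    [E.PreservesInjectiveObjects] {M : B} (I : InjectiveResolution M) :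
    InjectiveResolution (E.obj M) where
  cocomplex := (E.mapHomologicalComplex (ComplexShape.up ℕ)).obj I.cocomplex
  injective n := inferInstanceAs (Injective (E.obj (I.cocomplex.X n)))
  ι := (HomologicalComplex.singleMapHomologicalComplex E (ComplexShape.up ℕ) 0).inv.app M ≫
    (E.mapHomologicalComplex (ComplexShape.up ℕ)).map I.ι
  quasiIso := inferInstance

/-- An exact functor `E` preserving injective objects sends injective resolutions to injective
resolutions, so that `Rⁿ(G ∘ E) ≅ RⁿG ∘ E`. -/
def rightDerivedPrecompIso [HasInjectiveResolutions B] (E : B ⥤ C) [E.Additive]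
    [E.PreservesHomology] [E.PreservesInjectiveObjects] (G : C ⥤ D) [G.Additive] (n : ℕ) (M : B) :
    ((E ⋙ G).rightDerived n).obj M ≅ (G.rightDerived n).obj (E.obj M) :=
  rightDerivedHomologyIso (E ⋙ G) (injectiveResolution M) n ≪≫
    (rightDerivedHomologyIso G (mapInjectiveResolution E (injectiveResolution M)) n).symm

/-- Isomorphic functors have isomorphic right derived functors. -/
def rightDerivedCongr {G H : C ⥤ D} [G.Additive] [H.Additive] (e : G ≅ H) (n : ℕ) :
    G.rightDerived n ≅ H.rightDerived n where
  hom := NatTrans.rightDerived e.hom n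
  inv := NatTrans.rightDerived e.inv n
  hom_inv_id := by rw [← NatTrans.rightDerived_comp, e.hom_inv_id, NatTrans.rightDerived_id]
  inv_hom_id := by rw [← NatTrans.rightDerived_comp, e.inv_hom_id, NatTrans.rightDerived_id]

theorem isZero_rightDerived_succ_of_preservesHomology (G : C ⥤ D) [G.Additive]
    [G.PreservesHomology] (n : ℕ) (M : C) : IsZero ((G.rightDerived (n + 1)).obj M) :=
  let I := injectiveResolution M
  (G.map_isZero (I.cocomplex_exactAt_succ n).isZero_homology).of_iso
    (rightDerivedHomologyIso G I (n + 1) ≪≫ homologyMapComplexIso G I.cocomplex (n + 1))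

end ExactFunctors

section LongExactSequence

theorem mono_homologyMap_zero {K L : CochainComplex D ℕ} (φ : K ⟶ L) [Mono φ] :
    Mono (HomologicalComplex.homologyMap φ 0) := by
  rw [← mono_comp_iff_of_isIso (K.homologyπ 0), HomologicalComplex.homologyπ_naturality]
  infer_instance

variable (S : ShortComplex (C ⥤ D)) [S.X₁.Additive] [S.X₂.Additive] [S.X₃.Additive]

/-- A complex of functors `G₁ ⟶ G₂ ⟶ G₃`, applied degreewise to a cochain complex. -/
abbrev mapCochainComplex (K : CochainComplex C ℕ) : ShortComplex (CochainComplex D ℕ) :=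
  ShortComplex.mk
    ((NatTrans.mapHomologicalComplex S.f (ComplexShape.up ℕ)).app K)
    ((NatTrans.mapHomologicalComplex S.g (ComplexShape.up ℕ)).app K)
    (by ext n; exact NatTrans.congr_app S.zero (K.X n))

variable {S} (hS : ∀ (J : C) [Injective J], (S.map ((evaluation C D).obj J)).ShortExact)

include hS in
theorem mapCochainComplex_shortExact {M : C} (I : InjectiveResolution M) :
    (mapCochainComplex S I.cocomplex).ShortExact :=
  HomologicalComplex.shortExact_of_degreewise_shortExact _ fun n => hS (I.cocomplex.X n)

variable [HasInjectiveResolutions C] (M : C)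

include hS in
theorem mono_rightDerived_zero : Mono ((NatTrans.rightDerived S.f 0).app M) := by
  let I := injectiveResolution M
  have := (mapCochainComplex_shortExact hS I).mono_f
  have := mono_homologyMap_zero (mapCochainComplex S I.cocomplex).f
  rw [← mono_comp_iff_of_mono _ (rightDerivedHomologyIso S.X₂ I 0).hom,
    rightDerivedHomologyIso_hom_naturality]
  infer_instance

/-- The connecting morphism `RⁿG₃(M) ⟶ Rⁿ⁺¹G₁(M)` of a complex of functors `G₁ ⟶ G₂ ⟶ G₃` which is
short exact on injective objects. -/
def rightDerivedδ (n : ℕ) : (S.X₃.rightDerived n).obj M ⟶ (S.X₁.rightDerived (n + 1)).obj M :=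
  let I := injectiveResolution M
  (rightDerivedHomologyIso S.X₃ I n).hom ≫
    (mapCochainComplex_shortExact hS I).δ n (n + 1) (by simp) ≫
      (rightDerivedHomologyIso S.X₁ I (n + 1)).inv

theorem rightDerivedδ_comp_rightDerivedHomologyIso_hom (n : ℕ) :
    rightDerivedδ hS M n ≫ (rightDerivedHomologyIso S.X₁ (injectiveResolution M) (n + 1)).hom =
      (rightDerivedHomologyIso S.X₃ (injectiveResolution M) n).hom ≫
        (mapCochainComplex_shortExact hS (injectiveResolution M)).δ n (n + 1) (by simp) := by
  rw [rightDerivedδ, Category.assoc, Category.assoc, Iso.inv_hom_id, Category.comp_id]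

theorem rightDerivedδ_comp (n : ℕ) :
    rightDerivedδ hS M n ≫ (NatTrans.rightDerived S.f (n + 1)).app M = 0 := by
  let I := injectiveResolution M
  have h := (mapCochainComplex_shortExact hS I).δ_comp n (n + 1) (by simp)
  rw [← cancel_mono (rightDerivedHomologyIso S.X₂ I (n + 1)).hom, Category.assoc,
    rightDerivedHomologyIso_hom_naturality,
    reassoc_of% (rightDerivedδ_comp_rightDerivedHomologyIso_hom hS M n), h, comp_zero, zero_comp]

theorem comp_rightDerivedδ (n : ℕ) :
    (NatTrans.rightDerived S.g n).app M ≫ rightDerivedδ hS M n = 0 := by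
  let I := injectiveResolution M
  have h := (mapCochainComplex_shortExact hS I).comp_δ n (n + 1) (by simp)
  rw [← cancel_mono (rightDerivedHomologyIso S.X₁ I (n + 1)).hom, Category.assoc,
    rightDerivedδ_comp_rightDerivedHomologyIso_hom,
    reassoc_of% (rightDerivedHomologyIso_hom_naturality S.g I n), h, comp_zero, zero_comp]

theorem rightDerived_comp_eq_zero (S : ShortComplex (C ⥤ D)) [S.X₁.Additive] [S.X₂.Additive]
    [S.X₃.Additive] (n : ℕ) (M : C) :
    (NatTrans.rightDerived S.f n).app M ≫ (NatTrans.rightDerived S.g n).app M = 0 := by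
  let I := injectiveResolution M
  rw [← cancel_mono (rightDerivedHomologyIso S.X₃ I n).hom, Category.assoc,
    rightDerivedHomologyIso_hom_naturality,
    reassoc_of% (rightDerivedHomologyIso_hom_naturality S.f I n),
    ← HomologicalComplex.homologyMap_comp, (mapCochainComplex S I.cocomplex).zero,
    HomologicalComplex.homologyMap_zero, comp_zero, zero_comp]

theorem rightDerived_exact₁ (n : ℕ) :
    (ShortComplex.mk _ _ (rightDerivedδ_comp hS M n)).Exact :=
  let I := injectiveResolution M
  ShortComplex.exact_of_iso (ShortComplex.isoMk (rightDerivedHomologyIso S.X₃ I n)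
    (rightDerivedHomologyIso S.X₁ I (n + 1)) (rightDerivedHomologyIso S.X₂ I (n + 1))
    (rightDerivedδ_comp_rightDerivedHomologyIso_hom hS M n).symm
    (rightDerivedHomologyIso_hom_naturality S.f I (n + 1)).symm).symm
    ((mapCochainComplex_shortExact hS I).homology_exact₁ n (n + 1) (by simp))

include hS in
theorem rightDerived_exact₂ (n : ℕ) :
    (ShortComplex.mk _ _ (rightDerived_comp_eq_zero S n M)).Exact :=
  let I := injectiveResolution M
  ShortComplex.exact_of_iso (ShortComplex.isoMk (rightDerivedHomologyIso S.X₁ I n)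
    (rightDerivedHomologyIso S.X₂ I n) (rightDerivedHomologyIso S.X₃ I n)
    (rightDerivedHomologyIso_hom_naturality S.f I n).symm
    (rightDerivedHomologyIso_hom_naturality S.g I n).symm).symm
    ((mapCochainComplex_shortExact hS I).homology_exact₂ n)

theorem rightDerived_exact₃ (n : ℕ) :
    (ShortComplex.mk _ _ (comp_rightDerivedδ hS M n)).Exact :=
  let I := injectiveResolution M
  ShortComplex.exact_of_iso (ShortComplex.isoMk (rightDerivedHomologyIso S.X₂ I n)
    (rightDerivedHomologyIso S.X₃ I n) (rightDerivedHomologyIso S.X₁ I (n + 1))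
    (rightDerivedHomologyIso_hom_naturality S.g I n).symm
    (rightDerivedδ_comp_rightDerivedHomologyIso_hom hS M n).symm).symm
    ((mapCochainComplex_shortExact hS I).homology_exact₃ n (n + 1) (by simp))

/-- The beginning of the long exact sequence, when `G₂` and `G₃` are left exact. -/
def rightDerivedZeroIsoKernel [PreservesFiniteLimits S.X₂] [PreservesFiniteLimits S.X₃] :
    (S.X₁.rightDerived 0).obj M ≅ kernel (S.g.app M) :=
  haveI := mono_rightDerived_zero hS M
  (rightDerived_exact₂ hS M 0).fIsKernel.conePointUniqueUpToIso (kernelIsKernel _) ≪≫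
    (kernel.mapIso _ _ (asIso (S.X₂.toRightDerivedZero.app M))
      (asIso (S.X₃.toRightDerivedZero.app M)) (toRightDerivedZero_naturality S.g M)).symm

/-- The beginning of the long exact sequence, when `G₂` and `G₃` are left exact and `R¹G₂(M)`
vanishes. -/
def rightDerivedOneIsoCokernel [PreservesFiniteLimits S.X₂] [PreservesFiniteLimits S.X₃]
    (h : IsZero ((S.X₂.rightDerived 1).obj M)) :
    (S.X₁.rightDerived 1).obj M ≅ cokernel (S.g.app M) :=
  haveI : Epi (rightDerivedδ hS M 0) := (rightDerived_exact₁ hS M 0).epi_f (h.eq_zero_of_tgt _)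
  (rightDerived_exact₃ hS M 0).gIsCokernel.coconePointUniqueUpToIso (cokernelIsCokernel _) ≪≫
    (cokernel.mapIso _ _ (asIso (S.X₂.toRightDerivedZero.app M))
      (asIso (S.X₃.toRightDerivedZero.app M)) (toRightDerivedZero_naturality S.g M)).symm

/-- Dimension shifting: the connecting morphism is an isomorphism when `RⁿG₂` and `Rⁿ⁺¹G₂` vanish
at `M`. -/
def rightDerivedSuccIso {n : ℕ} (h : IsZero ((S.X₂.rightDerived n).obj M))
    (h' : IsZero ((S.X₂.rightDerived (n + 1)).obj M)) :
    (S.X₁.rightDerived (n + 1)).obj M ≅ (S.X₃.rightDerived n).obj M :=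
  haveI : Mono (rightDerivedδ hS M n) := (rightDerived_exact₃ hS M n).mono_g (h.eq_zero_of_src _)
  haveI : Epi (rightDerivedδ hS M n) := (rightDerived_exact₁ hS M n).epi_f (h'.eq_zero_of_tgt _)
  haveI := isIso_of_mono_of_epi (rightDerivedδ hS M n)
  (asIso (rightDerivedδ hS M n)).symm

end LongExactSequence

end RightDerived

section RestrictionToOpenSubsets

section KanExtension

variable (E : Type*) [Category.{u} E] [Abelian E] [HasColimitsOfSize.{u, u} E] [AB5OfSize.{u, u} E]

theorem colim_preservesMonomorphisms_of_isFilteredOrEmpty (J : Type u) [SmallCategory J]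
    [IsFilteredOrEmpty J] : (colim : (J ⥤ E) ⥤ E).PreservesMonomorphisms := by
  rcases isEmpty_or_nonempty J with _ | _
  · exact ⟨fun {K _} _ _ =>
      (isColimitEquivIsInitialOfIsEmpty _ _ (colimit.isColimit K)).mono_from _⟩
  · have : IsFiltered J := {}
    infer_instance

theorem lan_preservesMonomorphisms {C D : Type u} [SmallCategory C] [SmallCategory D] (L : C ⥤ D)
    [∀ d, IsFilteredOrEmpty (CostructuredArrow L d)] :
    (L.lan : (C ⥤ E) ⥤ (D ⥤ E)).PreservesMonomorphisms where
  preserves {F G} φ _ := (NatTrans.mono_iff_mono_app _).2 fun d => by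
    have := colim_preservesMonomorphisms_of_isFilteredOrEmpty E (CostructuredArrow L d)
    have : (L.lan ⋙ (evaluation D E).obj d).PreservesMonomorphisms :=
      Functor.PreservesMonomorphisms.of_iso (lanEvaluationIsoColim E L d).symm
    exact inferInstanceAs (Mono ((L.lan ⋙ (evaluation D E).obj d).map φ))

end KanExtension

variable {A : Type u} [CommRing A] {X Y : TopCat.{u}} {f : X ⟶ Y} (hf : IsOpenEmbedding f)

instance (U : (Opens Y)ᵒᵖ) : IsFilteredOrEmpty (CostructuredArrow hf.functor.op U) where
  cocone_objs S T := by
    let W : CostructuredArrow hf.functor.op U :=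
      CostructuredArrow.mk (Y := op (S.left.unop ⊓ T.left.unop)) (homOfLE (fun y hy => by
        obtain ⟨x, hx, rfl⟩ := S.hom.unop.le hy
        obtain ⟨x', hx', h⟩ := T.hom.unop.le hy
        exact ⟨x, ⟨hx, hf.injective h ▸ hx'⟩, rfl⟩)).op
    exact ⟨W, CostructuredArrow.homMk (homOfLE inf_le_left).op rfl,
      CostructuredArrow.homMk (homOfLE inf_le_right).op rfl, trivial⟩
  cocone_maps S T i j := ⟨T, 𝟙 T, by ext; rfl⟩

instance sheafForget_preservesInjectiveObjects :
    (TopCat.Sheaf.forget (ModuleCat.{u} A) X).PreservesInjectiveObjects where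
  injective_obj {F} := (sheafificationAdjunction (Opens.grothendieckTopology X)
    (ModuleCat.{u} A)).map_injective F

instance pullback_preservesFiniteLimits (f : X ⟶ Y) :
    PreservesFiniteLimits (TopCat.Sheaf.pullback (ModuleCat.{u} A) f) := by
  have := @reflectsLimits_of_reflectsIsomorphisms
  exact Functor.sheafPullbackConstruction.preservesFiniteLimits (Opens.map f) _ _ _

instance pushforward_preservesInjectiveObjects (f : X ⟶ Y) :
    (TopCat.Sheaf.pushforward (ModuleCat.{u} A) f).PreservesInjectiveObjects :=
  Functor.preservesInjectiveObjects_of_adjunction_of_preservesMonomorphisms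
    (TopCat.Sheaf.pullbackPushforwardAdjunction (ModuleCat.{u} A) f)

/-- Restriction of sheaves along an open embedding. -/
abbrev openRestrict (A : Type u) [CommRing A] {f : X ⟶ Y} (hf : IsOpenEmbedding f) :
    TopCat.Sheaf (ModuleCat.{u} A) Y ⥤ TopCat.Sheaf (ModuleCat.{u} A) X :=
  hf.sheafPullback (ModuleCat.{u} A)

instance : PreservesFiniteLimits (openRestrict A hf) :=
  preservesFiniteLimits_of_natIso (hf.sheafPullbackIso (ModuleCat.{u} A))

instance : (openRestrict A hf).IsLeftAdjoint :=
  Functor.isLeftAdjoint_of_iso (hf.sheafPullbackIso (ModuleCat.{u} A))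

instance : (openRestrict A hf).Additive where
  map_add := rfl

instance openRestrict_preservesInjectiveObjects :
    (openRestrict A hf).PreservesInjectiveObjects where
  injective_obj {F} hF := by
    have := lan_preservesMonomorphisms (ModuleCat.{u} A) hf.functor.op
    have hF' : Injective F.presheaf :=
      (TopCat.Sheaf.forget (ModuleCat.{u} A) Y).injective_obj_of_injective hF
    exact (TopCat.Sheaf.forget (ModuleCat.{u} A) X).injective_of_map_injective
      ((hf.functor.op.lanAdjunction (ModuleCat.{u} A)).map_injective _ hF')

end RestrictionToOpenSubsets

section Flasque

theorem isSplitEpi_map_of_injective {C : Type*} [Category.{u} C] {E : Type*} [Category* E]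
    [HasCoproducts.{u} E] [MonoCoprod E] (F : Cᵒᵖ ⥤ E) [Injective F]
    {U V : C} (i : V ⟶ U) [Mono i] : IsSplitEpi (F.map i.op) := by
  let M := F.obj (op V)
  let j : Presheaf.freeYoneda V M ⟶ Presheaf.freeYoneda U M :=
    Functor.whiskerRight (yoneda.map i) (sigmaConst.obj M)
  have : Mono j := by
    have (W : Cᵒᵖ) : Mono (j.app W) :=
      inferInstanceAs (Mono ((sigmaConst.obj M).map ((yoneda.map i).app W)))
    exact NatTrans.mono_of_mono_app j
  have restrict (m : M ⟶ F.obj (op U)) : j ≫ Presheaf.freeYonedaHomEquiv.symm m =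
      Presheaf.freeYonedaHomEquiv.symm (m ≫ F.map i.op) := by
    ext W
    refine Sigma.hom_ext _ _ fun φ => ?_
    change Sigma.ι (fun _ : W.unop ⟶ V => M) φ ≫
        Sigma.map' ((yoneda.map i).app W) (fun _ => 𝟙 M) ≫
          Sigma.desc (fun ψ : W.unop ⟶ U => m ≫ F.map ψ.op) =
      Sigma.ι (fun _ : W.unop ⟶ V => M) φ ≫
        Sigma.desc (fun ψ : W.unop ⟶ V => (m ≫ F.map i.op) ≫ F.map ψ.op)
    simp
  let t := Injective.factorThru (Presheaf.freeYonedaHomEquiv.symm (𝟙 M)) j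
  refine ⟨⟨⟨Presheaf.freeYonedaHomEquiv t, Presheaf.freeYonedaHomEquiv.symm.injective ?_⟩⟩⟩
  rw [← restrict, Equiv.symm_apply_apply, Injective.comp_factorThru]

theorem isFlasque_of_injective {A : Type u} [CommRing A] {X : TopCat.{u}}
    (F : TopCat.Sheaf (ModuleCat.{u} A) X) [hF : Injective F] : F.IsFlasque where
  epi i := by
    have : Injective F.presheaf :=
      (TopCat.Sheaf.forget (ModuleCat.{u} A) X).injective_obj_of_injective hF
    have := isSplitEpi_map_of_injective F.presheaf i.unop
    exact inferInstanceAs (Epi (F.presheaf.map i.unop.op))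

end Flasque

section Support

variable {A : Type u} [CommRing A] {X Y : TopCat.{u}}

theorem map_eq_zero_iff_of_eq (F : TopCat.Presheaf (ModuleCat.{u} A) X) {U V W : Opens X}
    (h : V = W) (i : V ⟶ U) (j : W ⟶ U) (s : F.obj (op U)) :
    F.map i.op s = 0 ↔ F.map j.op s = 0 := by
  subst h
  rw [Subsingleton.elim i j]

/-- The stalk at `x` of the sections supported in `Z`: local Morse data is the cohomology of its
right derived functor. -/
abbrev stalkWithSupport (A : Type u) [CommRing A] (Z : Closeds X) (x : X) :
    TopCat.Sheaf (ModuleCat.{u} A) X ⥤ ModuleCat.{u} A :=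
  sectionsWithSupport A Z ⋙ TopCat.Sheaf.forget (ModuleCat.{u} A) X ⋙
    TopCat.Presheaf.stalkFunctor (ModuleCat.{u} A) x

section OpenRestrict

variable {f : X ⟶ Y} (hf : IsOpenEmbedding f) {Z : Closeds Y} {Z' : Closeds X}
  (hZ : ∀ x, x ∈ Z' ↔ f x ∈ Z)

include hZ in
theorem supportedFamily_openRestrict (F : TopCat.Sheaf (ModuleCat.{u} A) Y) (U : Opens X) :
    (supportedFamily Z' ((openRestrict A hf).obj F)).carrier U =
      (supportedFamily Z F).carrier (hf.functor.obj U) := by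
  ext s
  refine map_eq_zero_iff_of_eq F.presheaf (V := hf.functor.obj (U ⊓ Z'.compl)) ?_
    (hf.functor.map (homOfLE inf_le_left)) _ s
  ext y
  constructor
  · rintro ⟨x, ⟨hx, hxZ⟩, rfl⟩
    exact ⟨⟨x, hx, rfl⟩, fun h => hxZ ((hZ x).2 h)⟩
  · rintro ⟨⟨x, hx, rfl⟩, hy⟩
    exact ⟨x, ⟨hx, fun h => hy ((hZ x).1 h)⟩, rfl⟩

/-- `Γ_Z` commutes with restriction to open subsets. -/
def openRestrictSectionsWithSupportIso :
    openRestrict A hf ⋙ sectionsWithSupport A Z' ⋙ TopCat.Sheaf.forget (ModuleCat.{u} A) X ≅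
      sectionsWithSupport A Z ⋙ TopCat.Sheaf.forget (ModuleCat.{u} A) Y ⋙
        (Functor.whiskeringLeft _ _ _).obj hf.functor.op :=
  NatIso.ofComponents (fun F => NatIso.ofComponents (fun U =>
      (LinearEquiv.ofEq _ _ (supportedFamily_openRestrict hf hZ F U.unop)).toModuleIso)
      (fun _ => rfl))
    (fun _ => rfl)

/-- Germs at `f x` can be computed on the open neighbourhoods contained in the image of `f`. -/
def openRestrictStalkIso (x : X) :
    (Functor.whiskeringLeft _ _ _).obj hf.functor.op ⋙
        TopCat.Presheaf.stalkFunctor (ModuleCat.{u} A) x ≅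
      TopCat.Presheaf.stalkFunctor (ModuleCat.{u} A) (f x) :=
  haveI := Functor.initial_of_adjunction (hf.adjunctionNhds x)
  ((Functor.whiskeringLeft _ _ _).obj (OpenNhds.inclusion (f x)).op).isoWhiskerLeft
    (Functor.Final.colimIso (hf.functorNhds x).op)

/-- `stalkWithSupport` is invariant under restriction to an open neighbourhood of the point. -/
def openRestrictStalkWithSupportIso (x : X) :
    openRestrict A hf ⋙ stalkWithSupport A Z' x ≅ stalkWithSupport A Z (f x) :=
  Functor.isoWhiskerRight (openRestrictSectionsWithSupportIso hf hZ)
      (TopCat.Presheaf.stalkFunctor (ModuleCat.{u} A) x) ≪≫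
    (sectionsWithSupport A Z ⋙ TopCat.Sheaf.forget (ModuleCat.{u} A) Y).isoWhiskerLeft
      (openRestrictStalkIso hf x)

end OpenRestrict

section Pushforward

variable (f : X ⟶ Y) {Z : Closeds Y} {Z' : Closeds X} (hZ : ∀ x, x ∈ Z' ↔ f x ∈ Z)

include hZ in
theorem supportedFamily_pushforward (F : TopCat.Sheaf (ModuleCat.{u} A) X) (U : Opens Y) :
    (supportedFamily Z ((TopCat.Sheaf.pushforward (ModuleCat.{u} A) f).obj F)).carrier U =
      (supportedFamily Z' F).carrier ((Opens.map f).obj U) := by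
  ext s
  refine map_eq_zero_iff_of_eq F.presheaf ?_
    ((Opens.map f).map (homOfLE (inf_le_left : U ⊓ Z.compl ≤ U))) (homOfLE inf_le_left) s
  ext x
  exact and_congr_right fun _ => not_congr (hZ x).symm

/-- `Γ_Z` commutes with direct images. -/
def pushforwardSectionsWithSupportIso :
    TopCat.Sheaf.pushforward (ModuleCat.{u} A) f ⋙ sectionsWithSupport A Z ⋙
        TopCat.Sheaf.forget (ModuleCat.{u} A) Y ≅
      sectionsWithSupport A Z' ⋙ TopCat.Sheaf.forget (ModuleCat.{u} A) X ⋙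
        TopCat.Presheaf.pushforward (ModuleCat.{u} A) f :=
  NatIso.ofComponents (fun F => NatIso.ofComponents (fun U =>
      (LinearEquiv.ofEq _ _ (supportedFamily_pushforward f hZ F U.unop)).toModuleIso)
      (fun _ => rfl))
    (fun _ => rfl)

variable {f} (hf : IsInducing f)

/-- The open neighbourhoods of `x` are cofinally the preimages of open neighbourhoods of `f x`. -/
def pushforwardStalkIso (x : X) :
    TopCat.Presheaf.pushforward (ModuleCat.{u} A) f ⋙
        TopCat.Presheaf.stalkFunctor (ModuleCat.{u} A) (f x) ≅
      TopCat.Presheaf.stalkFunctor (ModuleCat.{u} A) x :=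
  haveI := Functor.initial_of_adjunction (hf.adjunctionNhds x)
  ((Functor.whiskeringLeft _ _ _).obj (OpenNhds.inclusion x).op).isoWhiskerLeft
    (Functor.Final.colimIso (OpenNhds.map f x).op)

/-- `stalkWithSupport` is invariant under direct image along an embedding. -/
def pushforwardStalkWithSupportIso (x : X) :
    TopCat.Sheaf.pushforward (ModuleCat.{u} A) f ⋙ stalkWithSupport A Z (f x) ≅
      stalkWithSupport A Z' x :=
  Functor.isoWhiskerRight (pushforwardSectionsWithSupportIso f hZ)
      (TopCat.Presheaf.stalkFunctor (ModuleCat.{u} A) (f x)) ≪≫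
    (sectionsWithSupport A Z' ⋙ TopCat.Sheaf.forget (ModuleCat.{u} A) X).isoWhiskerLeft
      (pushforwardStalkIso hf x)

instance : (TopCat.Sheaf.pushforward (ModuleCat.{u} A) f).Additive where
  map_add := rfl

theorem subsingleton_stalk_pushforward (F : TopCat.Sheaf (ModuleCat.{u} A) X) {y : Y}
    (hy : y ∉ closure (Set.range f)) :
    Subsingleton (((TopCat.Sheaf.pushforward (ModuleCat.{u} A) f).obj F).presheaf.stalk y) := by
  let G := ((TopCat.Sheaf.pushforward (ModuleCat.{u} A) f).obj F).presheaf
  let N : Opens Y := ⟨(closure (Set.range f))ᶜ, isClosed_closure.isOpen_compl⟩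
  refine subsingleton_of_forall_eq 0 fun t => ?_
  obtain ⟨U, hyU, s, rfl⟩ := G.exists_germ_eq t
  have hbot : (Opens.map f).obj (U ⊓ N) = ⊥ :=
    Opens.ext <| Set.eq_empty_of_forall_notMem fun x hx => hx.2 (subset_closure ⟨x, rfl⟩)
  have : Subsingleton (G.obj (op (U ⊓ N))) :=
    ModuleCat.subsingleton_of_isZero (F.isTerminalOfEqEmpty hbot).isZero
  rw [← G.germ_res_apply (homOfLE (inf_le_left : U ⊓ N ≤ U)) y ⟨hyU, hy⟩ s,
    Subsingleton.elim (G.map _ s) 0, map_zero]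

theorem pushforward_preservesEpimorphisms (hf : IsClosedEmbedding f) :
    (TopCat.Sheaf.pushforward (ModuleCat.{u} A) f).PreservesEpimorphisms where
  preserves {F G} φ hφ := by
    rw [← TopCat.Sheaf.isLocallySurjective_iff_epi,
      TopCat.Presheaf.locally_surjective_iff_surjective_on_stalks]
    intro y
    by_cases hy : y ∈ Set.range f
    · obtain ⟨x, rfl⟩ := hy
      have : (TopCat.Sheaf.forget (ModuleCat.{u} A) X ⋙
          TopCat.Presheaf.pushforward (ModuleCat.{u} A) f ⋙
            TopCat.Presheaf.stalkFunctor (ModuleCat.{u} A) (f x)).PreservesEpimorphisms :=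
        .of_iso ((TopCat.Sheaf.forget (ModuleCat.{u} A) X).isoWhiskerLeft
          (pushforwardStalkIso hf.isInducing x).symm)
      exact (ModuleCat.epi_iff_surjective _).1 (inferInstanceAs (Epi
        ((TopCat.Sheaf.forget (ModuleCat.{u} A) X ⋙
          TopCat.Presheaf.pushforward (ModuleCat.{u} A) f ⋙
            TopCat.Presheaf.stalkFunctor (ModuleCat.{u} A) (f x)).map φ)))
    · have hG := subsingleton_stalk_pushforward G (hf.isClosed_range.closure_eq.symm ▸ hy)
      exact fun t => ⟨0, hG.elim _ t⟩

theorem pushforward_preservesHomology (hf : IsClosedEmbedding f) :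
    (TopCat.Sheaf.pushforward (ModuleCat.{u} A) f).PreservesHomology := by
  have := pushforward_preservesEpimorphisms (A := A) hf
  exact Functor.preservesHomology_of_preservesEpis_and_kernels _

end Pushforward

section MorseData

variable {X Y : Type u} [TopologicalSpace X] [TopologicalSpace Y]

/-- The stalk is exact, so local Morse data is the right derived functor of `stalkWithSupport`. -/
def lmdIso (F : TopCat.Sheaf (ModuleCat.{u} A) (TopCat.of X)) (f : C(X, ℝ)) (x : X) (n : ℕ) :
    LMD F f x (Int.ofNat n) ≅
      ((stalkWithSupport A (superlevel f x) x).rightDerived n).obj F :=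
  (rightDerivedCompIso (sectionsWithSupport A (superlevel f x))
    (TopCat.Sheaf.forget (ModuleCat.{u} A) (TopCat.of X) ⋙
      TopCat.Presheaf.stalkFunctor (X := TopCat.of X) (ModuleCat.{u} A) x) n F).symm

/-- Local Morse data is functorial in the sheaf. -/
def lmdMapIso {F G : TopCat.Sheaf (ModuleCat.{u} A) (TopCat.of X)} (e : F ≅ G) (f : C(X, ℝ))
    (x : X) : ∀ i : ℤ, LMD F f x i ≅ LMD G f x i
  | Int.ofNat n =>
      (TopCat.Sheaf.forget (ModuleCat.{u} A) (TopCat.of X) ⋙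
        TopCat.Presheaf.stalkFunctor (X := TopCat.of X) (ModuleCat.{u} A) x).mapIso
          (((sectionsWithSupport A (superlevel f x)).rightDerived n).mapIso e)
  | Int.negSucc _ => Iso.refl _

/-- Direct image along a closed embedding is exact and preserves injective objects, so it commutes
with the right derived functors of `stalkWithSupport`. -/
def lmdPushforwardIso (ι : C(X, Y)) (hι : IsClosedEmbedding ι) (f : C(Y, ℝ)) (x : X)
    (F : TopCat.Sheaf (ModuleCat.{u} A) (TopCat.of X)) : ∀ i : ℤ,
    LMD ((TopCat.Sheaf.pushforward (ModuleCat.{u} A) (TopCat.ofHom ι)).obj F) f (ι x) i ≅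
      LMD F (f.comp ι) x i
  | Int.ofNat n =>
      haveI := pushforward_preservesHomology (A := A) (f := TopCat.ofHom ι) hι
      lmdIso _ f (ι x) n ≪≫
        (rightDerivedPrecompIso (TopCat.Sheaf.pushforward (ModuleCat.{u} A) (TopCat.ofHom ι))
          (stalkWithSupport A (superlevel f (ι x)) (ι x)) n F).symm ≪≫
        (rightDerivedCongr (pushforwardStalkWithSupportIso (f := TopCat.ofHom ι)
          (fun _ => Iff.rfl) hι.isInducing x) n).app F ≪≫
        (lmdIso F (f.comp ι) x n).symm
  | Int.negSucc _ => Iso.refl _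

/-- Restriction along an open embedding is exact and preserves injective objects, so it commutes
with the right derived functors of `stalkWithSupport`. -/
def lmdOpenRestrictIso (ι : C(X, Y)) (hι : IsOpenEmbedding ι) (f : C(Y, ℝ)) (x : X)
    (F : TopCat.Sheaf (ModuleCat.{u} A) (TopCat.of Y)) : ∀ i : ℤ,
    LMD ((openRestrict A (f := TopCat.ofHom ι) hι).obj F) (f.comp ι) x i ≅ LMD F f (ι x) i
  | Int.ofNat n =>
      lmdIso _ (f.comp ι) x n ≪≫
        (rightDerivedPrecompIso (openRestrict A (f := TopCat.ofHom ι) hι)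
          (stalkWithSupport A (superlevel (f.comp ι) x) x) n F).symm ≪≫
        (rightDerivedCongr (openRestrictStalkWithSupportIso (f := TopCat.ofHom ι) hι
          (fun _ => Iff.rfl) x) n).app F ≪≫
        (lmdIso F f (ι x) n).symm
  | Int.negSucc _ => Iso.refl _

end MorseData

end Support

section ConstantSheaf

variable {X Y : TopCat.{u}}

/-- Both sides are values at `A` of left adjoints of the global sections functor on `X`. -/
def pullbackConstSheafIso (A : Type u) [CommRing A] (f : X ⟶ Y) :
    (TopCat.Sheaf.pullback (ModuleCat.{u} A) f).obj (constSheaf A Y) ≅ constSheaf A X :=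
  (((constantSheafAdj (Opens.grothendieckTopology Y) (ModuleCat.{u} A)
      (T := (⊤ : Opens Y)) isTerminalTop).comp
    (TopCat.Sheaf.pullbackPushforwardAdjunction (ModuleCat.{u} A) f)).leftAdjointUniq
    (constantSheafAdj (Opens.grothendieckTopology X) (ModuleCat.{u} A)
      (T := (⊤ : Opens X)) isTerminalTop)).app (ModuleCat.of A A)

theorem isCocontinuous_functor_of_isOpenEmbedding {f : X ⟶ Y} (hf : IsOpenEmbedding f) :
    hf.functor.IsCocontinuous (Opens.grothendieckTopology X) (Opens.grothendieckTopology Y) :=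
  (hf.isOpenMap.adjunction.isCocontinuous_iff_coverPreserving _ _).2 (coverPreserving_opens_map f)

/-- Sheafification commutes with restriction to open subsets. -/
def openRestrictConstSheafIso (A : Type u) [CommRing A] {f : X ⟶ Y} (hf : IsOpenEmbedding f) :
    constSheaf A X ≅ (openRestrict A hf).obj (constSheaf A Y) :=
  haveI := hf.functor_isContinuous
  haveI := isCocontinuous_functor_of_isOpenEmbedding hf
  (hf.functor.pushforwardContinuousSheafificationCompatibility (ModuleCat.{u} A)
    (Opens.grothendieckTopology X) (Opens.grothendieckTopology Y)).app
      ((Functor.const _).obj (ModuleCat.of A A))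

variable {A : Type u} [CommRing A]

theorem constSection_comp_openRestrictConstSheafIso {f : X ⟶ Y} (hf : IsOpenEmbedding f) :
    constSection A X ≫ (openRestrictConstSheafIso A hf).hom.1 =
      Functor.whiskerLeft hf.functor.op (constSection A Y) :=
  haveI := hf.functor_isContinuous
  haveI := isCocontinuous_functor_of_isOpenEmbedding hf
  hf.functor.toSheafify_pullbackSheafificationCompatibility (ModuleCat.{u} A)
    (Opens.grothendieckTopology X) (Opens.grothendieckTopology Y)
      ((Functor.const _).obj (ModuleCat.of A A))

theorem isIso_stalkFunctor_map_constSection (x : X) :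
    IsIso ((TopCat.Presheaf.stalkFunctor (ModuleCat.{u} A) x).map (constSection A X)) :=
  TopCat.Presheaf.stalkFunctor_map_unit_toSheafify_isIso x _ _

theorem hasProperSupport_of_isClosedEmbedding {f : X ⟶ Y} (hf : IsClosedEmbedding f)
    (G : TopCat.Sheaf (ModuleCat.{u} A) X) (U : Opens Y)
    (s : G.presheaf.obj (op ((Opens.map f).obj U))) : HasProperSupport f G U s := by
  obtain ⟨C, hC, hCs⟩ := isClosed_supp_inter G (U := (Opens.map f).obj U) s
  have hincl : IsClosedEmbedding (Set.inclusion (supp_subset G s)) := by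
    refine ⟨IsEmbedding.inclusion _, ?_⟩
    rw [Set.range_inclusion]
    refine isClosed_induced_iff.2 ⟨C, hC, ?_⟩
    ext x
    exact ⟨fun hx => hCs.superset ⟨hx, x.2⟩, fun hx => (hCs.subset hx).1⟩
  have hres : IsClosedEmbedding ((U : Set Y).restrictPreimage f) := hf.restrictPreimage _
  exact (hres.comp hincl).isProperMap

theorem properFamily_carrier_eq_top [T2Space Y] [LocallyCompactSpace Y] {f : X ⟶ Y}
    (hf : IsClosedEmbedding f) (G : TopCat.Sheaf (ModuleCat.{u} A) X) (U : Opens Y) :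
    (properFamily f G).carrier U = ⊤ := by
  rw [eq_top_iff]
  exact fun s _ => hasProperSupport_of_isClosedEmbedding hf G U s

/-- Along a closed embedding every section has proper support, so `f_! = f_*`. -/
def properPushforwardIso [T2Space Y] [LocallyCompactSpace Y] {f : X ⟶ Y}
    (hf : IsClosedEmbedding f) (G : TopCat.Sheaf (ModuleCat.{u} A) X) :
    properPushforward f G ≅ (TopCat.Sheaf.pushforward (ModuleCat.{u} A) f).obj G :=
  (fullyFaithfulSheafToPresheaf (Opens.grothendieckTopology Y) (ModuleCat.{u} A)).preimageIso
    (NatIso.ofComponents (fun U => (LinearEquiv.ofTop _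
      (properFamily_carrier_eq_top hf G U.unop)).toModuleIso)
      (fun _ => rfl))

/-- `(A_X)_S` is the direct image of `A_S` when `S` is closed. -/
def cutOffConstSheafIso (A : Type u) [CommRing A] {X : Type u} [TopologicalSpace X] [T2Space X]
    [LocallyCompactSpace X] {S : Set X} (hS : IsClosed S) :
    cutOff (constSheaf A (TopCat.of X)) S ≅
      (TopCat.Sheaf.pushforward (ModuleCat.{u} A) (incl S)).obj (constSheaf A (TopCat.of S)) :=
  haveI : T2Space (TopCat.of X) := ‹T2Space X›
  haveI : LocallyCompactSpace (TopCat.of X) := ‹LocallyCompactSpace X›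
  properPushforwardIso (f := incl S) hS.isClosedEmbedding_subtypeVal _ ≪≫
    (TopCat.Sheaf.pushforward (ModuleCat.{u} A) (incl S)).mapIso (pullbackConstSheafIso A (incl S))

end ConstantSheaf

section Cohomology

variable {A : Type u} [CommRing A] {X : TopCat.{u}}

/-- Evaluation of presheaves at `W`, through which `sections A W` factors. -/
def presheafEval (A : Type u) [CommRing A] (W : (Opens X)ᵒᵖ) :
    TopCat.Presheaf (ModuleCat.{u} A) X ⥤ ModuleCat.{u} A :=
  (evaluation (Opens X)ᵒᵖ (ModuleCat.{u} A)).obj W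

instance (W : (Opens X)ᵒᵖ) : PreservesFiniteLimits (presheafEval A W) :=
  inferInstanceAs (PreservesFiniteLimits ((evaluation (Opens X)ᵒᵖ (ModuleCat.{u} A)).obj W))

instance (W : (Opens X)ᵒᵖ) : PreservesFiniteColimits (presheafEval A W) :=
  inferInstanceAs (PreservesFiniteColimits ((evaluation (Opens X)ᵒᵖ (ModuleCat.{u} A)).obj W))

instance (W : (Opens X)ᵒᵖ) : (presheafEval A W).Additive where
  map_add := rfl

instance (W : (Opens X)ᵒᵖ) : PreservesFiniteLimits (sections A W) :=
  comp_preservesFiniteLimits (TopCat.Sheaf.forget (ModuleCat.{u} A) X) (presheafEval A W)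

instance (F : TopCat.Sheaf (ModuleCat.{u} A) X) : IsIso (toCohomologyZero F) :=
  (NatTrans.isIso_iff_isIso_app _).2 fun W =>
    inferInstanceAs (IsIso ((sections A W).toRightDerivedZero.app F))

/-- `Γ(W; -)` is the forgetful functor to presheaves followed by evaluation at `W`, which is
exact. -/
def cohomologyIso (F : TopCat.Sheaf (ModuleCat.{u} A) X) (n : ℕ) :
    ((TopCat.Sheaf.forget (ModuleCat.{u} A) X).rightDerived n).obj F ≅ cohomology F n :=
  (NatIso.ofComponents (fun W : (Opens X)ᵒᵖ =>
      rightDerivedCompIso (TopCat.Sheaf.forget (ModuleCat.{u} A) X) (presheafEval A W) n F)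
    (fun i => rightDerivedCompIso_hom_naturality (TopCat.Sheaf.forget (ModuleCat.{u} A) X)
      (L := presheafEval A _) (L' := presheafEval A _)
      ((evaluation (Opens X)ᵒᵖ (ModuleCat.{u} A)).map i) n F) :
    cohomology F n ≅ ((TopCat.Sheaf.forget (ModuleCat.{u} A) X).rightDerived n).obj F).symm

end Cohomology

section SupportSequence

variable {A : Type u} [CommRing A] {X Y : TopCat.{u}}

theorem shortExact_of_evaluation {C D : Type*} [Category* C] [Category* D] [Abelian D]
    (S : ShortComplex (C ⥤ D)) (h : ∀ W, (S.map ((evaluation C D).obj W)).ShortExact) :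
    S.ShortExact where
  exact := by
    rw [ShortComplex.exact_iff_isZero_homology, Functor.isZero_iff]
    intro W
    exact (((S.map _).exact_iff_isZero_homology).1 (h W).exact).of_iso
      (S.mapHomologyIso ((evaluation C D).obj W)).symm
  mono_f := (NatTrans.mono_iff_mono_app _).2 fun W => (h W).mono_f
  epi_g := (NatTrans.epi_iff_epi_app _).2 fun W => (h W).epi_g

/-- The inclusion `Γ_Z F ⟶ F`. -/
def supportInclusion (A : Type u) [CommRing A] (Z : Closeds Y) :
    sectionsWithSupport A Z ⋙ TopCat.Sheaf.forget (ModuleCat.{u} A) Y ⟶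
      TopCat.Sheaf.forget (ModuleCat.{u} A) Y where
  app _ := { app := fun _ => ModuleCat.ofHom (Submodule.subtype _)
             naturality := fun _ _ _ => rfl }
  naturality _ _ _ := rfl

/-- The restriction `F ⟶ f_* f⁻¹ F` of presheaves, for an open embedding `f`. -/
def restrictionUnit (A : Type u) [CommRing A] {f : X ⟶ Y} (hf : IsOpenEmbedding f) :
    𝟭 (TopCat.Presheaf (ModuleCat.{u} A) Y) ⟶
      (Functor.whiskeringLeft _ _ _).obj hf.functor.op ⋙
        TopCat.Presheaf.pushforward (ModuleCat.{u} A) f :=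
  (hf.isOpenMap.adjunction.op.whiskerLeft (ModuleCat.{u} A)).unit

variable {f : X ⟶ Y} (hf : IsOpenEmbedding f) {Z : Closeds Y}

theorem mem_supportedFamily_iff_restrictionUnit (hZ : Set.range f = (Z : Set Y)ᶜ)
    (F : TopCat.Sheaf (ModuleCat.{u} A) Y) (U : Opens Y) (s : F.presheaf.obj (op U)) :
    s ∈ (supportedFamily Z F).carrier U ↔
      ((restrictionUnit A hf).app F.presheaf).app (op U) s = 0 := by
  refine map_eq_zero_iff_of_eq F.presheaf ?_ _ (hf.isOpenMap.adjunction.counit.app U) s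
  ext y
  constructor
  · rintro ⟨hy, hyZ⟩
    obtain ⟨x, rfl⟩ := hZ.superset hyZ
    exact ⟨x, hy, rfl⟩
  · rintro ⟨x, hx, rfl⟩
    exact ⟨hx, hZ.subset ⟨x, rfl⟩⟩

/-- The complex of functors `Γ_Z ⟶ id ⟶ j_* j⁻¹` with values in presheaves, where `j` is the
inclusion of the complement of `Z`. -/
abbrev supportComplex (A : Type u) [CommRing A] (hf : IsOpenEmbedding f)
    (hZ : Set.range f = (Z : Set Y)ᶜ) :
    ShortComplex (TopCat.Sheaf (ModuleCat.{u} A) Y ⥤ TopCat.Presheaf (ModuleCat.{u} A) Y) :=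
  ShortComplex.mk (supportInclusion A Z)
    (Functor.whiskerLeft (TopCat.Sheaf.forget (ModuleCat.{u} A) Y) (restrictionUnit A hf)) (by
      ext F U s
      exact (mem_supportedFamily_iff_restrictionUnit hf hZ F U s.1).1 s.2)

theorem supportComplex_shortExact (hZ : Set.range f = (Z : Set Y)ᶜ)
    (J : TopCat.Sheaf (ModuleCat.{u} A) Y) [Injective J] :
    ((supportComplex A hf hZ).map ((evaluation _ _).obj J)).ShortExact :=
  shortExact_of_evaluation _ fun U =>
    { exact := (ShortComplex.moduleCat_exact_iff _).2 fun s hs =>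
        ⟨⟨s, (mem_supportedFamily_iff_restrictionUnit hf hZ J U.unop s).2 hs⟩, rfl⟩
      mono_f := (ModuleCat.mono_iff_injective _).2 Subtype.val_injective
      epi_g := (isFlasque_of_injective J).epi (hf.isOpenMap.adjunction.counit.app U.unop).op }

instance (f : X ⟶ Y) : PreservesFiniteLimits (TopCat.Presheaf.pushforward (ModuleCat.{u} A) f) :=
  inferInstanceAs (PreservesFiniteLimits ((Functor.whiskeringLeft _ _ _).obj _))

instance (f : X ⟶ Y) : PreservesFiniteColimits (TopCat.Presheaf.pushforward (ModuleCat.{u} A) f) :=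
  inferInstanceAs (PreservesFiniteColimits ((Functor.whiskeringLeft _ _ _).obj _))

instance (f : X ⟶ Y) : (TopCat.Presheaf.pushforward (ModuleCat.{u} A) f).Additive where
  map_add := rfl

instance (x : X) : PreservesFiniteLimits (TopCat.Presheaf.stalkFunctor (ModuleCat.{u} A) x) :=
  comp_preservesFiniteLimits ((Functor.whiskeringLeft _ _ _).obj (OpenNhds.inclusion x).op) colim

/-- The stalk at a point of `Y` of the direct image of presheaves. -/
abbrev directStalk (A : Type u) [CommRing A] (f : X ⟶ Y) (y : Y) :
    TopCat.Presheaf (ModuleCat.{u} A) X ⥤ ModuleCat.{u} A :=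
  TopCat.Presheaf.pushforward (ModuleCat.{u} A) f ⋙
    TopCat.Presheaf.stalkFunctor (ModuleCat.{u} A) y

/-- The stalk at `y` of the complex `Γ_Z ⟶ id ⟶ j_* j⁻¹`. -/
abbrev stalkSupportComplex (A : Type u) [CommRing A] (hf : IsOpenEmbedding f)
    (hZ : Set.range f = (Z : Set Y)ᶜ) (y : Y) :
    ShortComplex (TopCat.Sheaf (ModuleCat.{u} A) Y ⥤ ModuleCat.{u} A) where
  X₁ := stalkWithSupport A Z y
  X₂ := TopCat.Sheaf.forget (ModuleCat.{u} A) Y ⋙ TopCat.Presheaf.stalkFunctor (ModuleCat.{u} A) y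
  X₃ := openRestrict A hf ⋙ TopCat.Sheaf.forget (ModuleCat.{u} A) X ⋙ directStalk A f y
  f := Functor.whiskerRight (supportComplex A hf hZ).f
    (TopCat.Presheaf.stalkFunctor (ModuleCat.{u} A) y)
  g := Functor.whiskerRight (supportComplex A hf hZ).g
    (TopCat.Presheaf.stalkFunctor (ModuleCat.{u} A) y)
  zero := by
    have h := (supportComplex A hf hZ).zero
    ext F : 2
    refine ((TopCat.Presheaf.stalkFunctor (ModuleCat.{u} A) y).map_comp _ _).symm.trans ?_
    exact (congrArg _ (NatTrans.congr_app h F)).trans (Functor.map_zero _ _ _)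

theorem stalkSupportComplex_shortExact (hZ : Set.range f = (Z : Set Y)ᶜ) (y : Y)
    (J : TopCat.Sheaf (ModuleCat.{u} A) Y) [Injective J] :
    ((stalkSupportComplex A hf hZ y).map ((evaluation _ _).obj J)).ShortExact :=
  (supportComplex_shortExact hf hZ J).map_of_exact
    (TopCat.Presheaf.stalkFunctor (ModuleCat.{u} A) y)

end SupportSequence

section ReducedCohomology

variable {A : Type u} [CommRing A] {X Y : TopCat.{u}} {f : X ⟶ Y} (hf : IsOpenEmbedding f)
  {Z : Closeds Y} (y : Y)

/-- The derived functors of `F ↦ (f_* f⁻¹ F)_y`, where `directStalk` is exact and `f⁻¹` is exact and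
preserves injective objects. -/
def directStalkCohomologyIso (n : ℕ) :
    ((openRestrict A hf ⋙ TopCat.Sheaf.forget (ModuleCat.{u} A) X ⋙
        directStalk A f y).rightDerived n).obj (constSheaf A Y) ≅
      (directStalk A f y).obj (cohomology (constSheaf A X) n) :=
  rightDerivedPrecompIso (openRestrict A hf)
      (TopCat.Sheaf.forget (ModuleCat.{u} A) X ⋙ directStalk A f y) n (constSheaf A Y) ≪≫
    ((TopCat.Sheaf.forget (ModuleCat.{u} A) X ⋙ directStalk A f y).rightDerived n).mapIso
      (openRestrictConstSheafIso A hf).symm ≪≫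
    rightDerivedCompIso (TopCat.Sheaf.forget (ModuleCat.{u} A) X) (directStalk A f y) n _ ≪≫
    (directStalk A f y).mapIso (cohomologyIso (constSheaf A X) n)

/-- Sheafification does not change stalks, so the stalk of `A_Y` is that of the constant
presheaf. -/
def stalkConstSheafIso :
    (directStalk A f y).obj ((Functor.const (Opens X)ᵒᵖ).obj (ModuleCat.of A A)) ≅
      (constSheaf A Y).presheaf.stalk y :=
  @asIso _ _ _ _ _ (isIso_stalkFunctor_map_constSection (A := A) y)

/-- Zeroth cohomology is the sheaf itself. -/
def directStalkCohomologyZeroIso :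
    (directStalk A f y).obj (cohomology (constSheaf A X) 0) ≅
      (openRestrict A hf ⋙ TopCat.Sheaf.forget (ModuleCat.{u} A) X ⋙
        directStalk A f y).obj (constSheaf A Y) :=
  (directStalk A f y).mapIso ((asIso (toCohomologyZero (constSheaf A X))).symm ≪≫
    (TopCat.Sheaf.forget (ModuleCat.{u} A) X).mapIso (openRestrictConstSheafIso A hf))

theorem augmentation_comp_openRestrictConstSheafIso :
    augmentation A X ≫ (asIso (toCohomologyZero (constSheaf A X))).inv ≫
      (openRestrictConstSheafIso A hf).hom.1 =
        Functor.whiskerLeft hf.functor.op (constSection A Y) := by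
  rw [← constSection_comp_openRestrictConstSheafIso hf, augmentation, Category.assoc]
  exact congrArg (constSection A X ≫ ·)
    ((asIso (toCohomologyZero (constSheaf A X))).hom_inv_id_assoc _)

theorem pushforward_map_whiskerLeft_constSection :
    (TopCat.Presheaf.pushforward (ModuleCat.{u} A) f).map
        (Functor.whiskerLeft hf.functor.op (constSection A Y)) =
      constSection A Y ≫ (restrictionUnit A hf).app (constSheaf A Y).presheaf :=
  NatTrans.ext (funext fun U => (Category.id_comp _).symm.trans
    ((constSection A Y).naturality (hf.isOpenMap.adjunction.counit.app U.unop).op))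

theorem directStalk_map_augmentation (hZ : Set.range f = (Z : Set Y)ᶜ) :
    (directStalk A f y).map (augmentation A X) ≫ (directStalkCohomologyZeroIso hf y).hom =
      (stalkConstSheafIso y).hom ≫ (stalkSupportComplex A hf hZ y).g.app (constSheaf A Y) := by
  refine ((directStalk A f y).map_comp _ _).symm.trans ?_
  refine (congrArg (directStalk A f y).map
    (augmentation_comp_openRestrictConstSheafIso hf)).trans ?_
  refine (congrArg (TopCat.Presheaf.stalkFunctor (ModuleCat.{u} A) y).map
    (pushforward_map_whiskerLeft_constSection hf)).trans ?_
  exact Functor.map_comp _ _ _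

/-- The derived functors of `stalkWithSupport` read off the long exact sequence of
`stalkSupportComplex`, whose middle term is exact: degree `0` is the kernel of
`(A_Y)_y ⟶ (f_* A_X)_y`, degree `1` its cokernel, and the connecting morphism is an isomorphism in
higher degrees. -/
def stalkWithSupportRightDerivedIso (hZ : Set.range f = (Z : Set Y)ᶜ) : ∀ n : ℕ,
    ((stalkWithSupport A Z y).rightDerived n).obj (constSheaf A Y) ≅
      (directStalk A f y).obj (reducedCohomology A X (Int.ofNat n - 1))
  | 0 =>
      rightDerivedZeroIsoKernel (stalkSupportComplex_shortExact hf hZ y) (constSheaf A Y) ≪≫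
        (kernel.mapIso _ _ _ _ (directStalk_map_augmentation hf y hZ)).symm ≪≫
        (PreservesKernel.iso (directStalk A f y) (augmentation A X)).symm
  | 1 =>
      rightDerivedOneIsoCokernel (stalkSupportComplex_shortExact hf hZ y) (constSheaf A Y)
          (isZero_rightDerived_succ_of_preservesHomology _ 0 _) ≪≫
        (cokernel.mapIso _ _ _ _ (directStalk_map_augmentation hf y hZ)).symm ≪≫
        (PreservesCokernel.iso (directStalk A f y) (augmentation A X)).symm
  | n + 2 =>
      rightDerivedSuccIso (stalkSupportComplex_shortExact hf hZ y) (constSheaf A Y)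
          (isZero_rightDerived_succ_of_preservesHomology _ n _)
          (isZero_rightDerived_succ_of_preservesHomology _ (n + 1) _) ≪≫
        directStalkCohomologyIso hf y (n + 1) ≪≫
        eqToIso (congrArg (fun m => (directStalk A f y).obj (reducedCohomology A X m))
          (show Int.ofNat (n + 1) = Int.ofNat (n + 2) - 1 by lia))

end ReducedCohomology

section MorseDataOfConstantSheaf

variable {A : Type u} [CommRing A] {X : Type u} [TopologicalSpace X] (f : C(X, ℝ)) (x : X)

theorem isOpenEmbedding_incl_sublevel : IsOpenEmbedding (incl {y : X | f y < f x}) :=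
  (isOpen_lt f.continuous continuous_const).isOpenEmbedding_subtypeVal

theorem range_incl_sublevel :
    Set.range (incl {y : X | f y < f x}) = (superlevel f x : Set (TopCat.of X))ᶜ :=
  Subtype.range_coe.trans (Set.ext fun y => (not_le (a := f x) (b := f y)).symm)

theorem isZero_limReducedCohomology_negSucc_succ (n : ℕ) :
    IsZero (limReducedCohomology A f x (Int.negSucc (n + 1))) :=
  (directStalk A (incl {y : X | f y < f x}) x).map_isZero
    ((Functor.isZero_iff _).2 fun _ => ModuleCat.isZero_of_subsingleton (ModuleCat.of A PUnit))

/-- In nonnegative degrees this is `stalkWithSupportRightDerivedIso`, for the open embedding of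
`{f < f x}`. -/
def lmdConstSheafIso : ∀ i : ℤ,
    LMD (constSheaf A (TopCat.of X)) f x i ≅ limReducedCohomology A f x (i - 1)
  | Int.ofNat n => lmdIso _ f x n ≪≫
      stalkWithSupportRightDerivedIso (isOpenEmbedding_incl_sublevel f x) x
        (range_incl_sublevel f x) n
  | Int.negSucc n => (ModuleCat.isZero_of_subsingleton (ModuleCat.of A PUnit)).iso
      (isZero_limReducedCohomology_negSucc_succ f x n)

/-- The local Morse data of `(A_X)_S`, for closed `S`, are those of `A_S`. -/
def lmdCutOffConstSheafIso [T2Space X] [LocallyCompactSpace X] {S : Set X} (hS : IsClosed S)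
    (x : S) (i : ℤ) :
    LMD (cutOff (constSheaf A (TopCat.of X)) S) f x.1 i ≅
      LMD (constSheaf A (TopCat.of S)) (f.restrict S) x i :=
  lmdMapIso (cutOffConstSheafIso A hS) f x.1 i ≪≫
    lmdPushforwardIso ⟨Subtype.val, continuous_subtype_val⟩ hS.isClosedEmbedding_subtypeVal f x
      (constSheaf A (TopCat.of S)) i

/-- Restriction of constant sheaves along an open embedding does not change local Morse data. -/
def lmdConstSheafCompIso {U : Type u} [TopologicalSpace U] (ι : C(U, X)) (hι : IsOpenEmbedding ι)
    (x : U) (i : ℤ) :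
    LMD (constSheaf A (TopCat.of U)) (f.comp ι) x i ≅ LMD (constSheaf A (TopCat.of X)) f (ι x) i :=
  lmdMapIso (openRestrictConstSheafIso A (f := TopCat.ofHom ι) hι) (f.comp ι) x i ≪≫
    lmdOpenRestrictIso ι hι f x (constSheaf A (TopCat.of X)) i

end MorseDataOfConstantSheaf

end LocalMorse

end

theorem mainTheorem10_general {A : Type u} [CommRing A]
    {X : Type u} [TopologicalSpace X] [T2Space X] [LocallyCompactSpace X]
    (f : C(X, ℝ)) (S : Set X) (hS : IsClosed S) (V : Opens S) (x : S) (hx : x ∈ V) (i : ℤ) :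
    Nonempty
        (LocalMorse.LMD (LocalMorse.cutOff (LocalMorse.constSheaf A (TopCat.of X)) S) f x.1 i ≅
          LocalMorse.LMD (LocalMorse.constSheaf A (TopCat.of S)) (f.restrict S) x i) ∧
      Nonempty
        (LocalMorse.LMD (LocalMorse.constSheaf A (TopCat.of S)) (f.restrict S) x i ≅
          LocalMorse.LMD (LocalMorse.constSheaf A (TopCat.of V)) ((f.restrict S).restrict V)
            ⟨x, hx⟩ i) ∧
      Nonempty
        (LocalMorse.LMD (LocalMorse.constSheaf A (TopCat.of V)) ((f.restrict S).restrict V)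
            ⟨x, hx⟩ i ≅
          LocalMorse.limReducedCohomology A (f.restrict S) x (i - 1)) :=
  let localIso := LocalMorse.lmdConstSheafCompIso (A := A) (f.restrict S)
    (⟨Subtype.val, continuous_subtype_val⟩ : C(V, S)) V.2.isOpenEmbedding_subtypeVal ⟨x, hx⟩ i
  ⟨⟨LocalMorse.lmdCutOffConstSheafIso f hS x i⟩, ⟨localIso.symm⟩,
    ⟨localIso ≪≫ LocalMorse.lmdConstSheafIso (f.restrict S) x i⟩⟩

theorem mainTheorem10 {A : Type u} [CommRing A] [IsDomain A] [IsPrincipalIdealRing A]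
    {X : Type u} [TopologicalSpace X] [T2Space X] [LocallyCompactSpace X]
    (f : C(X, ℝ)) (S : Set X) (hS : IsClosed S) (V : Opens S) (x : S) (hx : x ∈ V) (i : ℤ) :
    Nonempty
        (LocalMorse.LMD (LocalMorse.cutOff (LocalMorse.constSheaf A (TopCat.of X)) S) f x.1 i ≅
          LocalMorse.LMD (LocalMorse.constSheaf A (TopCat.of S)) (f.restrict S) x i) ∧
      Nonempty
        (LocalMorse.LMD (LocalMorse.constSheaf A (TopCat.of S)) (f.restrict S) x i ≅
          LocalMorse.LMD (LocalMorse.constSheaf A (TopCat.of V)) ((f.restrict S).restrict V)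
            ⟨x, hx⟩ i) ∧
      Nonempty
        (LocalMorse.LMD (LocalMorse.constSheaf A (TopCat.of V)) ((f.restrict S).restrict V)
            ⟨x, hx⟩ i ≅
          LocalMorse.limReducedCohomology A (f.restrict S) x (i - 1)) :=
  mainTheorem10_general f S hS V x hx i
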